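/- Let $A$ be an alphabet, let $G=\{(a,\varepsilon,a):a\in A\}\cup\{(\varepsilon,a,a):a\in A\}$ and let $U$ be the submonoid of $A^*\times A^*\times A^*$ generated by $G$. A splitter $\mathcal S$ with finite state set $Q$ is a finite automaton over $U$ with transitions labelled in $G$ and with sets $I,T\subseteq Q$ of initial and final states; its behaviour $|\mathcal S|\subseteq U$ is the set of labels of its successful computations. It is functional if $(u_1,v_1,s),(u_2,v_2,s)\in|\mathcal S|$ implies $u_1=u_2$ and $v_1=v_2$. Let $H_A=(A^*\times\{\varepsilon\})\cup(\{\varepsilon\}\times A^*)\cup\{\mathbf 0\}$, with $\mathbf 0\cdot(f,g)=\mathbf 0$ and $(h,k)\cdot(f,g)=((kg)^{-1}hf,\varepsilon)$ if $kg$ is a prefix of $hf$, $(\varepsilon,(hf)^{-1}kg)$ if $hf$ is a prefix of $kg$, and $\mathbf 0$ otherwise. Let $\Delta$ be the action on $H_A\times H_A$ given by $(h',h'')\cdot_\Delta((f',g'),(f'',g''))=(h'\cdot(f',f''),h''\cdot(g',g''))$. Consider the following procedure on input $\mathcal S$. (1) Build the accessible part of the square automaton $\mathcal S\times\mathcal S$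 (states $Q\times Q$; pairs of transitions of $\mathcal S$ reading the same input letter), and then, backwards from its final states, its trim part $\mathcal A$, with state set $Q_{\mathcal A}$. (2) Build the accessible states of the product $\mathcal A\times\Delta$, starting from the initial states of $\mathcal A$ with value $((\varepsilon,\varepsilon),(\varepsilon,\varepsilon))$; answer "no" as soon as more than $|Q_{\mathcal A}|$ states appear. (3) Check that every state of $\mathcal A$ occurs in exactly one state of the product, and that the value at every final state is $((\varepsilon,\varepsilon),(\varepsilon,\varepsilon))$; answer "yes" if so and "no" otherwise. Then the procedure halts on every splitter $\mathcal S$, and it answers "yes" if and only if $\mathcal S$ is functional. Its running time is quadratic in the number of states of $\mathcal S$, when building or checking one state of one of these automata, together with the transitions at that state, is one unit of time: there is a constant $C$, independent of $A$ and $\mathcal S$, such that it takes at most $C\,|Q|^2$ units. Moreover, if at most $d$ transitions leave each state of $\mathcal S$, it takes at most $C\,((1+d^2)|Q|^2+1)$ elementary steps, where an elementary step examines one pair of transitions (or one pair of initial or final states), checks one state, or passes to the next phase; transitions are given indexed by their source and by their target, and a table lookup and an operation on $H_A$ have unit cost. -/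

import Mathlib

/-! ### The Shuffling Monoid -/

/-- The set `G = {(a, ε, a)} ∪ {(ε, a, a)}` of generators. -/
def shufflingGenerators (A : Type*) : Set (FreeMonoid A × FreeMonoid A × FreeMonoid A) :=
  {x | ∃ a : A, x = (FreeMonoid.of a, 1, FreeMonoid.of a)} ∪
    {x | ∃ a : A, x = (1, FreeMonoid.of a, FreeMonoid.of a)}

/-- The Shuffling Monoid `U`, generated by `G` inside `A* × A* × A*`. -/
def ShufflingMonoid (A : Type*) : Submonoid (FreeMonoid A × FreeMonoid A × FreeMonoid A) :=
  Submonoid.closure (shufflingGenerators A)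

/-- Names for the elements of `G`: `left a` is `(a, ε, a)` and `right a` is `(ε, a, a)`. -/
inductive Gen (A : Type*) where
  | left (a : A)
  | right (a : A)
  deriving DecidableEq

namespace Gen

variable {A : Type*}

/-- Input letter (third coordinate). -/
def letter : Gen A → A
  | left a => a
  | right a => a

/-- Word written on the left output tape (first coordinate). -/
def outL : Gen A → List A
  | left a => [a]
  | right _ => []

/-- Word written on the right output tape (second coordinate). -/
def outR : Gen A → List A
  | left _ => []
  | right a => [a]

/-- The triple that a name stands for. -/
def toTriple (g : Gen A) : FreeMonoid A × FreeMonoid A × FreeMonoid A :=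
  (FreeMonoid.ofList g.outL, FreeMonoid.ofList g.outR, FreeMonoid.of g.letter)

theorem range_toTriple : Set.range (toTriple (A := A)) = shufflingGenerators A := by
  ext x
  constructor
  · rintro ⟨g, rfl⟩
    cases g with
    | left a => exact Or.inl ⟨a, rfl⟩
    | right a => exact Or.inr ⟨a, rfl⟩
  · rintro (⟨a, rfl⟩ | ⟨a, rfl⟩)
    · exact ⟨left a, rfl⟩
    · exact ⟨right a, rfl⟩

/-- The element of `U` that a name stands for. -/
def toU (g : Gen A) : ShufflingMonoid A :=
  ⟨g.toTriple, Submonoid.subset_closure (range_toTriple (A := A) ▸ Set.mem_range_self g)⟩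

end Gen

/-! ### Splitters and functionality -/

/-- A transition `src --lab--> dst` labelled in `G`. -/
structure Transition (A Q : Type*) where
  src : Q
  lab : Gen A
  dst : Q
  deriving DecidableEq

/-- A splitter (spliffer) over the alphabet `A` with state set `Q`: an automaton over `U` labelled
in `G`. As input of an algorithm, its three finite sets (transitions, initial states, final states)
are listed without repetition. -/
structure Splitter (A Q : Type*) where
  E : List (Transition A Q)
  I : List Q
  T : List Q
  nodup_E : E.Nodup
  nodup_I : I.Nodup
  nodup_T : T.Nodup

namespace Splitter

variable {A Q : Type*}

/-- `S.Path p x q`: there is a computation from `p` to `q` whose label, the product in `U` of the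
labels of its transitions, is `x`. -/
inductive Path (S : Splitter A Q) : Q → ShufflingMonoid A → Q → Prop where
  | nil (q : Q) : Path S q 1 q
  | cons (e : Transition A Q) (x : ShufflingMonoid A) (q : Q) :
      e ∈ S.E → Path S e.dst x q → Path S e.src (e.lab.toU * x) q

/-- The behaviour `|S|`: the labels of the successful computations. -/
def behaviour (S : Splitter A Q) : Set (ShufflingMonoid A) :=
  {x | ∃ i ∈ S.I, ∃ f ∈ S.T, S.Path i x f}

/-- `S` is functional: `(u₁, v₁, s), (u₂, v₂, s) ∈ |S|` implies `u₁ = u₂` and `v₁ = v₂`. -/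
def Functional (S : Splitter A Q) : Prop :=
  ∀ (u₁ v₁ u₂ v₂ s : FreeMonoid A)
    (h₁ : (u₁, v₁, s) ∈ ShufflingMonoid A) (h₂ : (u₂, v₂, s) ∈ ShufflingMonoid A),
    (⟨(u₁, v₁, s), h₁⟩ : ShufflingMonoid A) ∈ S.behaviour →
    (⟨(u₂, v₂, s), h₂⟩ : ShufflingMonoid A) ∈ S.behaviour → u₁ = u₂ ∧ v₁ = v₂

end Splitter

/-! ### The Lead or Delay action -/

/-- `H_A = (A* × {ε}) ∪ ({ε} × A*) ∪ {𝟎}`, where `none` is `𝟎`. -/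
abbrev LeadDelay (A : Type*) := Option {h : List A × List A // h.1 = [] ∨ h.2 = []}

namespace LeadDelay

variable {A : Type*} [DecidableEq A]

/-- The element `(ε, ε)`. -/
def start : LeadDelay A := some ⟨([], []), Or.inl rfl⟩

/-- The action `h ·_δ (f, g)`; if `u` is a prefix of `w`, then `w.drop u.length` is `u⁻¹w`. -/
def act : LeadDelay A → List A → List A → LeadDelay A
  | none, _, _ => none
  | some h, f, g =>
    if h.1.2 ++ g <+: h.1.1 ++ f then
      some ⟨((h.1.1 ++ f).drop (h.1.2 ++ g).length, []), Or.inr rfl⟩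
    else if h.1.1 ++ f <+: h.1.2 ++ g then
      some ⟨([], (h.1.2 ++ g).drop (h.1.1 ++ f).length), Or.inl rfl⟩
    else none

/-- The bidimensional action `Δ` on `H_A × H_A`, applied to the outputs of two generators. -/
def act₂ (h : LeadDelay A × LeadDelay A) (g' g'' : Gen A) : LeadDelay A × LeadDelay A :=
  (h.1.act g'.outL g''.outL, h.2.act g'.outR g''.outR)

end LeadDelay

/-! ### The decision procedure, as a machine with a step function -/

/-- A state of the product of the square automaton with `Δ`. -/
abbrev ProductState (A Q : Type*) := (Q × Q) × (LeadDelay A × LeadDelay A)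

/-- Memory of the machine. A list `todo` holds the candidates still to be examined; a candidate is
the state to which a pair of transitions leads, or `none` when the pair is not a transition of the
automaton under construction. A list `built` holds the states built so far. -/
inductive Config (A Q : Type*) where
  /-- Building the accessible part of the square automaton. -/
  | access (built : List (Q × Q)) (todo : List (Option (Q × Q)))
  /-- Building its trim part, backwards from the final states. -/
  | trim (acc built : List (Q × Q)) (todo : List (Option (Q × Q)))
  /-- Building the product of the trim part (with state set `QA`) with `Δ`. -/
  | product (QA : List (Q × Q)) (built : List (ProductState A Q))
      (todo : List (Option (ProductState A Q)))
  /-- Checking the states of the product; `marked` are the states of the trim part met so far. -/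
  | check (QA marked : List (Q × Q)) (todo : List (ProductState A Q))
  /-- Stop with an answer. -/
  | halt (answer : Bool)

namespace Splitter

variable {A Q : Type*} [DecidableEq A] [DecidableEq Q]

/-- Transitions leaving `q`. -/
def out (S : Splitter A Q) (q : Q) : List (Transition A Q) := S.E.filter (fun e => e.src = q)

/-- Transitions entering `q`. -/
def into (S : Splitter A Q) (q : Q) : List (Transition A Q) := S.E.filter (fun e => e.dst = q)

/-- Candidates leaving `p` in the square automaton: two transitions that read the same letter. -/
def squareNext (S : Splitter A Q) (p : Q × Q) : List (Option (Q × Q)) :=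
  (S.out p.1 ×ˢ S.out p.2).map fun e =>
    if e.1.lab.letter = e.2.lab.letter then some (e.1.dst, e.2.dst) else none

/-- Candidates entering `p` in the accessible part `acc` of the square automaton. -/
def squarePrev (S : Splitter A Q) (acc : List (Q × Q)) (p : Q × Q) : List (Option (Q × Q)) :=
  (S.into p.1 ×ˢ S.into p.2).map fun e =>
    if e.1.lab.letter = e.2.lab.letter ∧ (e.1.src, e.2.src) ∈ acc then
      some (e.1.src, e.2.src) else none

/-- Candidates leaving `x` in the product with `Δ` of the trim part, whose state set is `QA`. -/
def productNext (S : Splitter A Q) (QA : List (Q × Q)) (x : ProductState A Q) :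
    List (Option (ProductState A Q)) :=
  (S.out x.1.1 ×ˢ S.out x.1.2).map fun e =>
    if e.1.lab.letter = e.2.lab.letter ∧ (e.1.dst, e.2.dst) ∈ QA then
      some ((e.1.dst, e.2.dst), LeadDelay.act₂ x.2 e.1.lab e.2.lab) else none

/-- The initial configuration. -/
def initial (S : Splitter A Q) : Config A Q := .access [] ((S.I ×ˢ S.I).map some)

/-- One elementary step: examine one candidate (building the state if it is new, which makes the
transitions at that state available), check one state, or pass to the next phase. -/
def step (S : Splitter A Q) : Config A Q → Config A Q
  | .access built [] =>
      .trim built [] ((S.T ×ˢ S.T).map fun p => if p ∈ built then some p else none)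
  | .access built (none :: todo) => .access built todo
  | .access built (some p :: todo) =>
      if p ∈ built then .access built todo
      else .access (p :: built) (S.squareNext p ++ todo)
  | .trim _ built [] =>
      .product built [] ((S.I ×ˢ S.I).map fun p =>
        if p ∈ built then some (p, (LeadDelay.start, LeadDelay.start)) else none)
  | .trim acc built (none :: todo) => .trim acc built todo
  | .trim acc built (some p :: todo) =>
      if p ∈ built then .trim acc built todo
      else .trim acc (p :: built) (S.squarePrev acc p ++ todo)
  | .product QA built [] => .check QA [] built
  | .product QA built (none :: todo) => .product QA built todo
  | .product QA built (some x :: todo) =>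
      if x ∈ built then .product QA built todo
      -- more than `|Q_A|` states: abort
      else if built.length + 1 > QA.length then .halt false
      else .product QA (x :: built) (S.productNext QA x ++ todo)
  -- the product is a valuation iff every state of `QA` has been met exactly once
  | .check QA marked [] => .halt (decide (marked.length = QA.length))
  | .check QA marked ((p, h) :: todo) =>
      if p ∈ marked then .halt false
      else if p.1 ∈ S.T ∧ p.2 ∈ S.T ∧ h ≠ (LeadDelay.start, LeadDelay.start) then .halt false
      else .check QA (p :: marked) todo
  | .halt answer => .halt answer

/-- The configuration after `t` elementary steps. -/
def configAt (S : Splitter A Q) (t : ℕ) : Config A Q := S.step^[t] S.initial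

/-- Does the next step build a new state, or check a state of the product? -/
def handlesState : Config A Q → Bool
  | .access built (some p :: _) => decide (p ∉ built)
  | .trim _ built (some p :: _) => decide (p ∉ built)
  | .product _ built (some x :: _) => decide (x ∉ built)
  | .check _ _ (_ :: _) => true
  | _ => false

/-- Running time up to step `t` when building or checking one state, together with the transitions
at it, is the unit of time. -/
def stateTime (S : Splitter A Q) (t : ℕ) : ℕ :=
  (List.range t).countP fun i => handlesState (S.configAt i)

end Splitter

/-! Every transition reads exactly one letter, so two computations of the splitter on the same input
are one computation of the square automaton. Functionality thus says that along every successful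
computation of the square the two left outputs agree, and so do the two right outputs
(`functional_iff`).

The action `Δ` computes the lead of one output over the other (`start_act_act`), and this lead is
`(ε, ε)` exactly when the outputs are equal. If a pair of words can be completed to equal words by
`f` and `g`, its lead depends on `f` and `g` only. In the trim part every state has a continuation
to a final state, so for a functional splitter all computations reaching a given state carry the
same value (`value_unique_of_functional`). The product then has exactly one state over each state of
the trim part, which justifies the abort, and final values are trivial. Conversely, trivial values
at final states already give functionality.

All three constructions are instances of one worklist exploration, whose final list is the reachable
set and whose cost is the number of candidates put on the worklist (`exists_run_explore`). Each
phase handles at most `|Q|²` states, the product because of the abort. The candidates number at most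
`d²|Q|²` beyond the initial ones; in the backward phase this is seen by counting all pairs of
transitions. -/

/-! ### Runs of the machine with their costs -/

namespace Splitter

variable {A Q : Type*} [DecidableEq A] [DecidableEq Q]

/-- `S.Run c t k c'`: the machine goes from `c` to `c'` in `t` steps, `k` of which handle a
state. -/
inductive Run (S : Splitter A Q) : Config A Q → ℕ → ℕ → Config A Q → Prop where
  | refl (c : Config A Q) : Run S c 0 0 c
  | idle {c c₁ c' : Config A Q} {t k : ℕ} : S.step c = c₁ → handlesState c = false →
      Run S c₁ t k c' → Run S c (t + 1) k c'
  | work {c c₁ c' : Config A Q} {t k : ℕ} : S.step c = c₁ → handlesState c = true →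
      Run S c₁ t k c' → Run S c (t + 1) (k + 1) c'

namespace Run

variable {S : Splitter A Q} {c c₁ c₂ : Config A Q} {t t₁ t₂ k k₁ k₂ : ℕ}

theorem trans (h₁ : S.Run c t₁ k₁ c₁) (h₂ : S.Run c₁ t₂ k₂ c₂) :
    S.Run c (t₁ + t₂) (k₁ + k₂) c₂ := by
  induction h₁ with
  | refl c => simpa using h₂
  | idle hs hh _ ih =>
    have := Run.idle hs hh (ih h₂)
    rwa [show ∀ a b : ℕ, a + 1 + b = a + b + 1 by omega]
  | work hs hh _ ih =>
    have := Run.work hs hh (ih h₂)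
    rwa [show ∀ a b : ℕ, a + 1 + b = a + b + 1 by omega,
      show ∀ a b : ℕ, a + 1 + b = a + b + 1 by omega]

theorem iterate_step (h : S.Run c t k c₁) : S.step^[t] c = c₁ := by
  induction h with
  | refl c => rfl
  | idle hs _ _ ih => rw [Function.iterate_succ_apply, hs, ih]
  | work hs _ _ ih => rw [Function.iterate_succ_apply, hs, ih]

/-- Identifies the counter `k` of a run with `stateTime`, as `iterate_step` identifies its end with
`configAt`. -/
theorem countP_handlesState (h : S.Run c t k c₁) :
    ((List.range t).countP fun i => handlesState (S.step^[i] c)) = k := by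
  induction h with
  | refl c => rfl
  | idle hs hh _ ih =>
    rw [List.range_succ_eq_map, List.countP_cons, List.countP_map]
    simp only [Function.comp_def, Function.iterate_succ_apply, hs, ih]
    simp [hh]
  | work hs hh _ ih =>
    rw [List.range_succ_eq_map, List.countP_cons, List.countP_map]
    simp only [Function.comp_def, Function.iterate_succ_apply, hs, ih]
    simp [hh]

end Run

/-! ### Worklist exploration -/

/-- The elements that a worklist exploration can meet. -/
inductive Reachable {α : Type*} (init : List (Option α)) (next : α → List (Option α)) : α → Prop
  | init {x : α} : some x ∈ init → Reachable init next x
  | next {x y : α} : Reachable init next y → some x ∈ next y → Reachable init next x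

/-- `explore built todo` is a family of configurations on which the machine performs a worklist
exploration along `next`, as long as fewer than `n` elements are built. -/
structure Explores (S : Splitter A Q) {α : Type*} (next : α → List (Option α)) (n : ℕ)
    (explore : List α → List (Option α) → Config A Q) : Prop where
  step_none : ∀ built todo, S.step (explore built (none :: todo)) = explore built todo
  step_old : ∀ built todo x, x ∈ built →
    S.step (explore built (some x :: todo)) = explore built todo
  step_new : ∀ built todo x, x ∉ built → built.length < n →
    S.step (explore built (some x :: todo)) = explore (x :: built) (next x ++ todo)
  idle_none : ∀ built todo, handlesState (explore built (none :: todo)) = false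
  idle_old : ∀ built todo x, x ∈ built → handlesState (explore built (some x :: todo)) = false
  work_new : ∀ built todo x, x ∉ built → handlesState (explore built (some x :: todo)) = true

/-- The invariant of a worklist exploration. -/
structure ExploreInv {α : Type*} (init : List (Option α)) (next : α → List (Option α))
    (built : List α) (todo : List (Option α)) : Prop where
  nodup : built.Nodup
  built_reachable : ∀ x ∈ built, Reachable init next x
  todo_reachable : ∀ x, some x ∈ todo → Reachable init next x
  init_mem : ∀ x, some x ∈ init → x ∈ built ∨ some x ∈ todo
  next_mem : ∀ y ∈ built, ∀ x, some x ∈ next y → x ∈ built ∨ some x ∈ todo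

namespace ExploreInv

variable {α : Type*} {init : List (Option α)} {next : α → List (Option α)} {built : List α}
  {todo : List (Option α)} {x : α}

theorem start : ExploreInv init next [] init :=
  ⟨List.nodup_nil, by simp, fun _ => .init, fun _ => .inr, by simp⟩

theorem skip_none (h : ExploreInv init next built (none :: todo)) :
    ExploreInv init next built todo where
  nodup := h.nodup
  built_reachable := h.built_reachable
  todo_reachable y hy := h.todo_reachable y (List.mem_cons_of_mem _ hy)
  init_mem y hy := by simpa using h.init_mem y hy
  next_mem z hz y hy := by simpa using h.next_mem z hz y hy

theorem skip_old (h : ExploreInv init next built (some x :: todo)) (hx : x ∈ built) :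
    ExploreInv init next built todo where
  nodup := h.nodup
  built_reachable := h.built_reachable
  todo_reachable y hy := h.todo_reachable y (List.mem_cons_of_mem _ hy)
  init_mem y hy := by
    rcases h.init_mem y hy with h | h
    · exact .inl h
    · rcases List.mem_cons.1 h with h | h
      · cases h; exact .inl hx
      · exact .inr h
  next_mem z hz y hy := by
    rcases h.next_mem z hz y hy with h | h
    · exact .inl h
    · rcases List.mem_cons.1 h with h | h
      · cases h; exact .inl hx
      · exact .inr h

theorem build (h : ExploreInv init next built (some x :: todo)) (hx : x ∉ built) :
    ExploreInv init next (x :: built) (next x ++ todo) where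
  nodup := List.nodup_cons.2 ⟨hx, h.nodup⟩
  built_reachable := by
    intro y hy
    rcases List.mem_cons.1 hy with rfl | hy
    · exact h.todo_reachable _ (by simp)
    · exact h.built_reachable y hy
  todo_reachable y hy := by
    rcases List.mem_append.1 hy with hy | hy
    · exact .next (h.todo_reachable x (by simp)) hy
    · exact h.todo_reachable y (List.mem_cons_of_mem _ hy)
  init_mem y hy := by
    have := h.init_mem y hy
    simp only [List.mem_cons, Option.some.injEq, List.mem_append] at this ⊢
    tauto
  next_mem z hz y hy := by
    rcases List.mem_cons.1 hz with rfl | hz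
    · exact .inr (List.mem_append_left _ hy)
    · have := h.next_mem z hz y hy
      simp only [List.mem_cons, Option.some.injEq, List.mem_append] at this ⊢
      tauto

/-- With an empty worklist, the invariant says that `built` contains the initial elements and is
closed under `next`. -/
theorem mem_iff (h : ExploreInv init next built []) : x ∈ built ↔ Reachable init next x := by
  refine ⟨h.built_reachable x, fun hx => ?_⟩
  induction hx with
  | init hx => simpa using h.init_mem _ hx
  | next _ hx ih => simpa using h.next_mem _ ih _ hx

end ExploreInv

/-- An exploration either terminates, or stops at a new element when `n` elements are built. -/
theorem exists_run_explore {S : Splitter A Q} {α : Type*}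
    {init : List (Option α)} {next : α → List (Option α)} {n : ℕ}
    {explore : List α → List (Option α) → Config A Q} (he : S.Explores next n explore)
    (built : List α) (todo : List (Option α)) (hinv : ExploreInv init next built todo)
    (hn : built.length ≤ n) :
    ∃ built' t k, built'.length ≤ n ∧ k + built.length = built'.length ∧
      t + (built.map fun x => (next x).length).sum ≤
        todo.length + (built'.map fun x => (next x).length).sum ∧
      ((S.Run (explore built todo) t k (explore built' []) ∧ ExploreInv init next built' []) ∨
      ∃ x todo', S.Run (explore built todo) t k (explore built' (some x :: todo')) ∧
        built'.length = n ∧ x ∉ built' ∧ ExploreInv init next built' (some x :: todo')) := by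
  -- The cost bound is an amortisation: each step consumes one candidate, and only building `x` adds
  -- any, namely `(next x).length` of them.
  match todo with
  | [] => exact ⟨built, 0, 0, hn, by simp, by simp, .inl ⟨.refl _, hinv⟩⟩
  | none :: todo =>
    obtain ⟨b, t, k, hb, hk, ht, h⟩ := exists_run_explore he built todo hinv.skip_none hn
    refine ⟨b, t + 1, k, hb, hk, by simp only [List.length_cons]; omega, ?_⟩
    exact h.imp (fun h => ⟨.idle (he.step_none _ _) (he.idle_none _ _) h.1, h.2⟩)
      fun ⟨x, l, h⟩ => ⟨x, l, .idle (he.step_none _ _) (he.idle_none _ _) h.1, h.2⟩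
  | some x :: todo =>
    by_cases hx : x ∈ built
    · obtain ⟨b, t, k, hb, hk, ht, h⟩ := exists_run_explore he built todo (hinv.skip_old hx) hn
      refine ⟨b, t + 1, k, hb, hk, by simp only [List.length_cons]; omega, ?_⟩
      exact h.imp (fun h => ⟨.idle (he.step_old _ _ _ hx) (he.idle_old _ _ _ hx) h.1, h.2⟩)
        fun ⟨x, l, h⟩ => ⟨x, l, .idle (he.step_old _ _ _ hx) (he.idle_old _ _ _ hx) h.1, h.2⟩
    · by_cases hlt : built.length < n
      · obtain ⟨b, t, k, hb, hk, ht, h⟩ := exists_run_explore he (x :: built) (next x ++ todo)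
          (hinv.build hx) hlt
        refine ⟨b, t + 1, k + 1, hb, by simp only [List.length_cons] at hk; omega, ?_, ?_⟩
        · simp only [List.length_cons, List.map_cons, List.sum_cons, List.length_append] at ht ⊢
          omega
        · exact h.imp
            (fun h => ⟨.work (he.step_new _ _ _ hx hlt) (he.work_new _ _ _ hx) h.1, h.2⟩)
            fun ⟨x, l, h⟩ =>
              ⟨x, l, .work (he.step_new _ _ _ hx hlt) (he.work_new _ _ _ hx) h.1, h.2⟩
      · exact ⟨built, 0, 0, hn, by simp, by simp,
          .inr ⟨x, todo, .refl _, by omega, hx, hinv⟩⟩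
-- Skipping a candidate shortens the worklist; building may lengthen it but brings `built.length`
-- closer to `n`.
termination_by (n - built.length, todo.length)

/-- An exploration that cannot outgrow the type of its elements terminates. -/
theorem exists_run_explore_of_card {S : Splitter A Q} {α : Type*} [Fintype α]
    {next : α → List (Option α)} {explore : List α → List (Option α) → Config A Q}
    (he : S.Explores next (Fintype.card α) explore) (init : List (Option α)) :
    ∃ built t, S.Run (explore [] init) t built.length (explore built []) ∧ built.Nodup ∧
      (∀ x, x ∈ built ↔ Reachable init next x) ∧
      t ≤ init.length + (built.map fun x => (next x).length).sum := by
  obtain ⟨b, t, k, -, hk, ht, h⟩ := exists_run_explore he [] init .start (by simp)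
  obtain rfl : k = b.length := by simpa using hk
  rcases h with ⟨hr, hi⟩ | ⟨x, todo, -, hl, hx, hi⟩
  · exact ⟨b, t, hr, hi.nodup, fun x => hi.mem_iff, by simpa using ht⟩
  -- Stopping early would give more distinct elements than the type has.
  · have := (List.nodup_cons.2 ⟨hx, hi.nodup⟩).length_le_card
    rw [List.length_cons] at this
    omega

/-! ### The phases of the machine as explorations -/

theorem explores_access (S : Splitter A Q) (n : ℕ) :
    S.Explores S.squareNext n Config.access where
  step_none _ _ := rfl
  step_old _ _ _ h := by simp [step, h]
  step_new _ _ _ h _ := by simp [step, h]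
  idle_none _ _ := rfl
  idle_old _ _ _ h := by simp [handlesState, h]
  work_new _ _ _ h := by simp [handlesState, h]

theorem explores_trim (S : Splitter A Q) (acc : List (Q × Q)) (n : ℕ) :
    S.Explores (S.squarePrev acc) n (Config.trim acc) where
  step_none _ _ := rfl
  step_old _ _ _ h := by simp [step, h]
  step_new _ _ _ h _ := by simp [step, h]
  idle_none _ _ := rfl
  idle_old _ _ _ h := by simp [handlesState, h]
  work_new _ _ _ h := by simp [handlesState, h]

theorem explores_product (S : Splitter A Q) (QA : List (Q × Q)) :
    S.Explores (S.productNext QA) QA.length (Config.product QA) where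
  step_none _ _ := rfl
  step_old _ _ _ h := by simp only [step, if_pos h]
  step_new _ _ _ h h' := by
    simp only [step, if_neg h]
    rw [if_neg (by omega)]
  idle_none _ _ := rfl
  idle_old _ _ _ h := by simp [handlesState, h]
  work_new _ _ _ h := by simp [handlesState, h]

/-- The condition on the states of the product that the checking phase tests. -/
def Consistent (S : Splitter A Q) (l : List (ProductState A Q)) : Prop :=
  (l.map Prod.fst).Nodup ∧ ∀ x ∈ l, x.1.1 ∈ S.T → x.1.2 ∈ S.T →
    x.2 = (LeadDelay.start, LeadDelay.start)

/-- The induction is on `todo` with `marked` arbitrary: what remains must be consistent, avoid the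
marked states, and bring their number to that of `QA`. Only the case `marked = []` is used later. -/
theorem exists_run_check (S : Splitter A Q) (QA : List (Q × Q)) (todo : List (ProductState A Q))
    (marked : List (Q × Q)) :
    ∃ t k answer, S.Run (.check QA marked todo) t k (.halt answer) ∧ t ≤ todo.length + 1 ∧
      k ≤ todo.length ∧ (answer = true ↔ S.Consistent todo ∧
        (∀ x ∈ todo, x.1 ∉ marked) ∧ todo.length + marked.length = QA.length) := by
  induction todo generalizing marked with
  | nil => exact ⟨1, 0, _, .idle rfl rfl (.refl _), le_rfl, le_rfl, by simp [Consistent]⟩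
  | cons x todo ih =>
    obtain ⟨p, h⟩ := x
    by_cases hp : p ∈ marked
    · refine ⟨1, 1, false, .work (by simp [step, hp]) rfl (.refl _), by simp, by simp, ?_⟩
      simp only [Bool.false_eq_true, false_iff]
      exact fun H => H.2.1 (p, h) (by simp) hp
    by_cases hT : p.1 ∈ S.T ∧ p.2 ∈ S.T ∧ h ≠ (LeadDelay.start, LeadDelay.start)
    · refine ⟨1, 1, false, .work (by simp only [step, if_neg hp, if_pos hT]) rfl (.refl _),
        by simp, by simp, ?_⟩
      simp only [Bool.false_eq_true, false_iff]
      exact fun H => hT.2.2 (H.1.2 (p, h) (by simp) hT.1 hT.2.1)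
    · obtain ⟨t, k, ans, hr, ht, hk, ha⟩ := ih (p :: marked)
      refine ⟨t + 1, k + 1, ans, .work (by simp only [step, if_neg hp, if_neg hT]) rfl hr,
        by simpa using ht, by simpa using hk, ha.trans ?_⟩
      have hT' : p.1 ∈ S.T → p.2 ∈ S.T → h = (LeadDelay.start, LeadDelay.start) := by tauto
      simp only [Consistent, List.map_cons, List.nodup_cons, List.mem_cons, List.length_cons,
        forall_eq_or_imp, not_or]
      constructor
      · rintro ⟨⟨h1, h2⟩, h3, h4⟩
        refine ⟨⟨⟨fun hm => ?_, h1⟩, hT', h2⟩, ⟨hp, fun x hx => (h3 x hx).2⟩, by omega⟩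
        obtain ⟨y, hy, rfl⟩ := List.mem_map.1 hm
        exact (h3 y hy).1 rfl
      · rintro ⟨⟨⟨h0, h1⟩, -, h2⟩, ⟨-, h3⟩, h4⟩
        exact ⟨⟨h1, h2⟩, fun x hx => ⟨fun he => h0 (List.mem_map.2 ⟨x, hx, he⟩), h3 x hx⟩,
          by omega⟩

end Splitter

/-! ### The Lead or Delay action computes the lead of one word over the other -/

namespace LeadDelay

variable {A : Type*} [DecidableEq A]

theorem start_act_append_left (u r : List A) :
    start.act (u ++ r) u = some ⟨(r, []), Or.inr rfl⟩ := by
  simp [start, act]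

theorem start_act_append_right (u r : List A) :
    start.act u (u ++ r) = some ⟨([], r), Or.inl rfl⟩ := by
  by_cases h : r = []
  · subst h; simp [start, act]
  · have : ¬ (u ++ r <+: u) := fun hp => h (by simpa using hp.length_le)
    simp [start, act, this]

theorem start_act_eq_none {u v : List A} (h₁ : ¬ v <+: u) (h₂ : ¬ u <+: v) :
    start.act u v = none := by
  simp [start, act, h₁, h₂]

theorem some_left_act (r f g : List A) :
    act (some ⟨(r, []), Or.inr rfl⟩) f g = start.act (r ++ f) g := by
  simp [start, act]

theorem some_right_act (r f g : List A) :
    act (some ⟨([], r), Or.inl rfl⟩) f g = start.act f (r ++ g) := by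
  simp [start, act]

theorem start_act_append_append (u f g : List A) :
    start.act (u ++ f) (u ++ g) = start.act f g := by
  simp only [start, act, List.nil_append, List.prefix_append_right_inj, List.length_append,
    ← List.drop_drop, List.drop_left]

/-- If one of `u`, `v` is a prefix of the other, the common part cancels. Otherwise they differ at
some position, and no extension repairs this, which is why `𝟎` is absorbing. -/
theorem start_act_act (u v f g : List A) :
    (start.act u v).act f g = start.act (u ++ f) (v ++ g) := by
  by_cases h₁ : v <+: u
  · obtain ⟨r, rfl⟩ := h₁
    rw [start_act_append_left, some_left_act, List.append_assoc, start_act_append_append]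
  by_cases h₂ : u <+: v
  · obtain ⟨r, rfl⟩ := h₂
    rw [start_act_append_right, some_right_act, List.append_assoc, start_act_append_append]
  rw [start_act_eq_none h₁ h₂, start_act_eq_none, act]
  · intro h
    rcases List.prefix_or_prefix_of_prefix ((List.prefix_append v g).trans h)
      (List.prefix_append u f) with h | h <;> contradiction
  · intro h
    rcases List.prefix_or_prefix_of_prefix ((List.prefix_append u f).trans h)
      (List.prefix_append v g) with h | h <;> contradiction

theorem start_act_eq_start {u v : List A} : start.act u v = start ↔ u = v := by
  refine ⟨fun h => ?_, fun h => ?_⟩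
  · by_cases h₁ : v <+: u
    · obtain ⟨r, rfl⟩ := h₁
      rw [start_act_append_left] at h
      simpa [start] using h
    by_cases h₂ : u <+: v
    · obtain ⟨r, rfl⟩ := h₂
      rw [start_act_append_right] at h
      simpa [start] using h
    rw [start_act_eq_none h₁ h₂] at h
    simp [start] at h
  · subst h
    have := start_act_append_left u []
    rwa [List.append_nil] at this

/-- The lead is determined by any completion to a pair of equal words. -/
theorem start_act_eq_of_append_eq {u v u' v' f g : List A} (h : u ++ f = v ++ g)
    (h' : u' ++ f = v' ++ g) : start.act u v = start.act u' v' := by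
  -- One of `f`, `g` is `r` followed by the other, and `r` is the lead. Cancelling the common suffix
  -- in `h'` shows that `u'` and `v'` differ by the same `r`.
  rcases List.append_eq_append_iff.1 h with ⟨r, rfl, rfl⟩ | ⟨r, rfl, rfl⟩
  · rw [← List.append_assoc, List.append_left_inj] at h'
    rw [← h', start_act_append_right, start_act_append_right]
  · rw [← List.append_assoc, List.append_left_inj] at h'
    rw [h', start_act_append_left, start_act_append_left]

end LeadDelay

/-! ### Computations of the square automaton -/

namespace Splitter

variable {A Q : Type*}

/-- Computations of `S`, labelled by sequences of names of generators. -/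
inductive GenPath (S : Splitter A Q) : Q → List (Gen A) → Q → Prop where
  | nil (q : Q) : GenPath S q [] q
  | cons (e : Transition A Q) (w : List (Gen A)) (q : Q) :
      e ∈ S.E → GenPath S e.dst w q → GenPath S e.src (e.lab :: w) q

/-- Computations of the square automaton `S × S`. -/
inductive PairPath (S : Splitter A Q) : Q × Q → List (Gen A × Gen A) → Q × Q → Prop where
  | nil (p : Q × Q) : PairPath S p [] p
  | cons (e e' : Transition A Q) (w : List (Gen A × Gen A)) (q : Q × Q) :
      e ∈ S.E → e' ∈ S.E → e.lab.letter = e'.lab.letter → PairPath S (e.dst, e'.dst) w q →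
      PairPath S (e.src, e'.src) ((e.lab, e'.lab) :: w) q

theorem coe_prod_toU (w : List (Gen A)) :
    ((w.map Gen.toU).prod : ShufflingMonoid A).1 = (FreeMonoid.ofList (w.flatMap Gen.outL),
      FreeMonoid.ofList (w.flatMap Gen.outR), FreeMonoid.ofList (w.map Gen.letter)) := by
  induction w with
  | nil => rfl
  | cons g w ih =>
    rw [List.map_cons, List.prod_cons, Submonoid.coe_mul, ih]
    rfl

/-- An element of `U` may factor over `G` in several ways, for instance `(a, a, aa)`, so the label
of a computation is traded for the sequence of its generators. -/
theorem path_iff {S : Splitter A Q} {p q : Q} {x : ShufflingMonoid A} :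
    S.Path p x q ↔ ∃ w, S.GenPath p w q ∧ (w.map Gen.toU).prod = x := by
  constructor
  · intro h
    induction h with
    | nil q => exact ⟨[], .nil q, rfl⟩
    | cons e x q he _ ih =>
      obtain ⟨w, hw, rfl⟩ := ih
      exact ⟨e.lab :: w, .cons e w q he hw, by simp⟩
  · rintro ⟨w, hw, rfl⟩
    induction hw with
    | nil q => exact .nil q
    | cons e w q he _ ih =>
      rw [List.map_cons, List.prod_cons]
      exact .cons e _ q he ih

namespace PairPath

variable {S : Splitter A Q}

theorem trans {p q r : Q × Q} {w w' : List (Gen A × Gen A)} (h : S.PairPath p w q)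
    (h' : S.PairPath q w' r) : S.PairPath p (w ++ w') r := by
  induction h with
  | nil p => exact h'
  | cons e e' w q he he' hl _ ih => exact .cons e e' _ _ he he' hl (ih h')

theorem genPath {p q : Q × Q} {w : List (Gen A × Gen A)} (h : S.PairPath p w q) :
    S.GenPath p.1 (w.map Prod.fst) q.1 ∧ S.GenPath p.2 (w.map Prod.snd) q.2 ∧
      (w.map Prod.fst).map Gen.letter = (w.map Prod.snd).map Gen.letter := by
  induction h with
  | nil p => exact ⟨.nil _, .nil _, rfl⟩
  | cons e e' w q he he' hl _ ih =>
    refine ⟨.cons e _ _ he ih.1, .cons e' _ _ he' ih.2.1, ?_⟩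
    simp only [List.map_cons] at ih ⊢
    rw [hl, ih.2.2]

theorem singleton {e e' : Transition A Q} (he : e ∈ S.E)
    (he' : e' ∈ S.E) (hl : e.lab.letter = e'.lab.letter) :
    S.PairPath (e.src, e'.src) [(e.lab, e'.lab)] (e.dst, e'.dst) :=
  .cons e e' [] _ he he' hl (.nil _)

/-- One letter per transition: computations with the same input have the same length and pair up
transition by transition. -/
theorem of_genPath {p q p' q' : Q} {w w' : List (Gen A)} (h : S.GenPath p w q)
    (h' : S.GenPath p' w' q') (hw : w.map Gen.letter = w'.map Gen.letter) :
    ∃ z, S.PairPath (p, p') z (q, q') ∧ z.map Prod.fst = w ∧ z.map Prod.snd = w' := by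
  induction h generalizing p' w' with
  | nil q =>
    cases h' with
    | nil => exact ⟨[], .nil _, rfl, rfl⟩
    | cons e' w' _ he' h' => simp at hw
  | cons e w q he _ ih =>
    cases h' with
    | nil => simp at hw
    | cons e' w' _ he' h' =>
      simp only [List.map_cons, List.cons.injEq] at hw
      obtain ⟨z, hz, rfl, rfl⟩ := ih h' hw.2
      exact ⟨_, .cons e e' z _ he he' hw.1 hz, rfl, rfl⟩

end PairPath

/-- The two left outputs of a computation of the square automaton agree, and so do the right
ones. -/
def Agree (w : List (Gen A × Gen A)) : Prop :=
  (w.map Prod.fst).flatMap Gen.outL = (w.map Prod.snd).flatMap Gen.outL ∧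
    (w.map Prod.fst).flatMap Gen.outR = (w.map Prod.snd).flatMap Gen.outR

theorem functional_iff {S : Splitter A Q} :
    S.Functional ↔ ∀ i f w, i.1 ∈ S.I → i.2 ∈ S.I → f.1 ∈ S.T → f.2 ∈ S.T →
      S.PairPath i w f → Agree w := by
  constructor
  · intro h i f w hi hi' hf hf' hw
    obtain ⟨h₁, h₂, hl⟩ := hw.genPath
    have e₁ := coe_prod_toU (w.map Prod.fst)
    have e₂ := coe_prod_toU (w.map Prod.snd)
    rw [← hl] at e₂
    have m₁ := ((w.map Prod.fst).map Gen.toU).prod.2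
    have m₂ := ((w.map Prod.snd).map Gen.toU).prod.2
    rw [e₁] at m₁
    rw [e₂] at m₂
    exact h _ _ _ _ _ m₁ m₂ ⟨i.1, hi, f.1, hf, path_iff.2 ⟨_, h₁, Subtype.ext e₁⟩⟩
      ⟨i.2, hi', f.2, hf', path_iff.2 ⟨_, h₂, Subtype.ext e₂⟩⟩
  · rintro h u₁ v₁ u₂ v₂ s m₁ m₂ ⟨i, hi, f, hf, hp⟩ ⟨i', hi', f', hf', hp'⟩
    obtain ⟨w, hw, e⟩ := path_iff.1 hp
    obtain ⟨w', hw', e'⟩ := path_iff.1 hp'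
    replace e := (coe_prod_toU w).symm.trans (congrArg Subtype.val e)
    replace e' := (coe_prod_toU w').symm.trans (congrArg Subtype.val e')
    simp only [Prod.mk.injEq] at e e'
    obtain ⟨rfl, rfl, rfl⟩ := e
    obtain ⟨rfl, rfl, hl⟩ := e'
    obtain ⟨z, hz, rfl, rfl⟩ := PairPath.of_genPath hw hw' (FreeMonoid.ofList.injective hl.symm)
    exact h _ _ z hi hi' hf hf' hz

/-! ### Values of computations, accessibility and coaccessibility -/

variable [DecidableEq A]

/-- The value in `H_A × H_A` of a computation of the square automaton. -/
def value (w : List (Gen A × Gen A)) : LeadDelay A × LeadDelay A :=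
  (LeadDelay.start.act ((w.map Prod.fst).flatMap Gen.outL) ((w.map Prod.snd).flatMap Gen.outL),
    LeadDelay.start.act ((w.map Prod.fst).flatMap Gen.outR) ((w.map Prod.snd).flatMap Gen.outR))

theorem value_nil : value ([] : List (Gen A × Gen A)) = (LeadDelay.start, LeadDelay.start) := by
  simp [value, LeadDelay.start_act_eq_start]

theorem value_concat (w : List (Gen A × Gen A)) (g g' : Gen A) :
    value (w ++ [(g, g')]) = LeadDelay.act₂ (value w) g g' := by
  simp [value, LeadDelay.act₂, LeadDelay.start_act_act]

theorem value_eq_start {w : List (Gen A × Gen A)} :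
    value w = (LeadDelay.start, LeadDelay.start) ↔ Agree w := by
  simp [value, Agree, LeadDelay.start_act_eq_start]

/-- The outputs of the common continuation `z` complete both pairs to equal words, so they determine
both leads. -/
theorem value_eq_of_agree {w w' z : List (Gen A × Gen A)} (h : Agree (w ++ z))
    (h' : Agree (w' ++ z)) : value w = value w' := by
  simp only [Agree, List.map_append, List.flatMap_append] at h h'
  exact Prod.ext (LeadDelay.start_act_eq_of_append_eq h.1 h'.1)
    (LeadDelay.start_act_eq_of_append_eq h.2 h'.2)

/-- Accessibility in the square automaton. -/
def Accessible (S : Splitter A Q) (p : Q × Q) : Prop :=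
  ∃ i w, i.1 ∈ S.I ∧ i.2 ∈ S.I ∧ S.PairPath i w p

/-- Coaccessibility in the square automaton. -/
def Coaccessible (S : Splitter A Q) (p : Q × Q) : Prop :=
  ∃ f w, f.1 ∈ S.T ∧ f.2 ∈ S.T ∧ S.PairPath p w f

/-! ### Correctness -/

section Correctness

variable {S : Splitter A Q} {QA : List (Q × Q)} {R : ProductState A Q → Prop}

/-- Coaccessibility provides one continuation to a final state, which serves both computations. Here
and below, `R` stands for reachability in the product. -/
theorem value_unique_of_functional (hS : S.Functional)
    (hQA : ∀ p, p ∈ QA ↔ S.Accessible p ∧ S.Coaccessible p)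
    (hR : ∀ x, R x ↔ x.1 ∈ QA ∧ ∃ i w, i.1 ∈ S.I ∧ i.2 ∈ S.I ∧ S.PairPath i w x.1 ∧ value w = x.2)
    {x y : ProductState A Q} (hx : R x) (hy : R y) (hxy : x.1 = y.1) : x = y := by
  obtain ⟨hp, i, w, hi, hi', hw, hv⟩ := (hR x).1 hx
  obtain ⟨-, j, z, hj, hj', hz, hv'⟩ := (hR y).1 hy
  obtain ⟨-, f, w', hf, hf', hw'⟩ := (hQA _).1 hp
  refine Prod.ext hxy ?_
  rw [← hv, ← hv']
  rw [functional_iff] at hS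
  exact value_eq_of_agree (hS i f _ hi hi' hf hf' (hw.trans hw'))
    (hS j f _ hj hj' hf hf' (hz.trans (hxy ▸ hw')))

theorem value_final_of_functional (hS : S.Functional)
    (hR : ∀ x, R x ↔ x.1 ∈ QA ∧ ∃ i w, i.1 ∈ S.I ∧ i.2 ∈ S.I ∧ S.PairPath i w x.1 ∧ value w = x.2)
    {x : ProductState A Q} (hx : R x) (h : x.1.1 ∈ S.T) (h' : x.1.2 ∈ S.T) :
    x.2 = (LeadDelay.start, LeadDelay.start) := by
  obtain ⟨-, i, w, hi, hi', hw, hv⟩ := (hR x).1 hx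
  rw [← hv, value_eq_start]
  exact functional_iff.1 hS i _ w hi hi' h h' hw

theorem functional_of_value_final
    (hQA : ∀ p, p ∈ QA ↔ S.Accessible p ∧ S.Coaccessible p)
    (hR : ∀ x, R x ↔ x.1 ∈ QA ∧ ∃ i w, i.1 ∈ S.I ∧ i.2 ∈ S.I ∧ S.PairPath i w x.1 ∧ value w = x.2)
    (h : ∀ x, R x → x.1.1 ∈ S.T → x.1.2 ∈ S.T → x.2 = (LeadDelay.start, LeadDelay.start)) :
    S.Functional := by
  rw [functional_iff]
  intro i f w hi hi' hf hf' hw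
  rw [← value_eq_start]
  exact h (f, value w) ((hR _).2 ⟨(hQA _).2 ⟨⟨i, w, hi, hi', hw⟩, f, [], hf, hf', .nil f⟩,
    i, w, hi, hi', hw, rfl⟩) hf hf'

/-- If `S` is functional, then distinct states of the product lie over distinct states of `QA`. -/
theorem nodup_map_fst_of_functional (hS : S.Functional)
    (hQA : ∀ p, p ∈ QA ↔ S.Accessible p ∧ S.Coaccessible p)
    (hR : ∀ x, R x ↔ x.1 ∈ QA ∧ ∃ i w, i.1 ∈ S.I ∧ i.2 ∈ S.I ∧ S.PairPath i w x.1 ∧ value w = x.2)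
    {l : List (ProductState A Q)} (hl : l.Nodup) (h : ∀ x ∈ l, R x) :
    (l.map Prod.fst).Nodup :=
  hl.map_on fun x hx y hy => value_unique_of_functional hS hQA hR (h x hx) (h y hy)

/-- Makes the abort sound: more than `QA.length` distinct reachable states refute functionality. -/
theorem length_le_of_functional (hS : S.Functional)
    (hQA : ∀ p, p ∈ QA ↔ S.Accessible p ∧ S.Coaccessible p)
    (hR : ∀ x, R x ↔ x.1 ∈ QA ∧ ∃ i w, i.1 ∈ S.I ∧ i.2 ∈ S.I ∧ S.PairPath i w x.1 ∧ value w = x.2)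
    {l : List (ProductState A Q)} (hl : l.Nodup) (h : ∀ x ∈ l, R x) :
    l.length ≤ QA.length := by
  rw [← List.length_map (f := Prod.fst) (as := l)]
  refine ((nodup_map_fst_of_functional hS hQA hR hl h).subperm fun p hp => ?_).length_le
  obtain ⟨x, hx, rfl⟩ := List.mem_map.1 hp
  exact ((hR x).1 (h x hx)).1

/-- Values at final states alone give functionality. Conversely, uniqueness of values bounds the
length above, and accessibility of every state of `QA` bounds it below. -/
theorem consistent_iff_functional (hnd : QA.Nodup)
    (hQA : ∀ p, p ∈ QA ↔ S.Accessible p ∧ S.Coaccessible p)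
    (hR : ∀ x, R x ↔ x.1 ∈ QA ∧ ∃ i w, i.1 ∈ S.I ∧ i.2 ∈ S.I ∧ S.PairPath i w x.1 ∧ value w = x.2)
    {l : List (ProductState A Q)} (hl : l.Nodup) (h : ∀ x, x ∈ l ↔ R x) :
    S.Consistent l ∧ l.length = QA.length ↔ S.Functional := by
  constructor
  · rintro ⟨⟨-, hc⟩, -⟩
    exact functional_of_value_final hQA hR fun x hx => hc x ((h x).2 hx)
  · intro hS
    refine ⟨⟨nodup_map_fst_of_functional hS hQA hR hl fun x => (h x).1,
      fun x hx => value_final_of_functional hS hR ((h x).1 hx)⟩,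
      le_antisymm (length_le_of_functional hS hQA hR hl fun x => (h x).1) ?_⟩
    rw [← List.length_map (f := Prod.fst) (as := l)]
    refine (hnd.subperm fun p hp => ?_).length_le
    obtain ⟨i, w, hi, hi', hw⟩ := ((hQA p).1 hp).1
    exact List.mem_map.2 ⟨(p, value w), (h _).2 ((hR _).2 ⟨hp, i, w, hi, hi', hw, rfl⟩), rfl⟩

end Correctness

theorem length_product_le [Fintype Q] {l : List Q} (hl : l.Nodup) :
    (l ×ˢ l).length ≤ Fintype.card Q ^ 2 := by
  rw [List.length_product, sq]
  exact Nat.mul_le_mul hl.length_le_card hl.length_le_card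

theorem length_le_card_sq [Fintype Q] {l : List (Q × Q)} (hl : l.Nodup) :
    l.length ≤ Fintype.card Q ^ 2 :=
  hl.length_le_card.trans (by rw [Fintype.card_prod, sq])

/-! ### The states that the machine builds -/

variable [DecidableEq Q]

theorem some_mem_squareNext {S : Splitter A Q} {p q : Q × Q} :
    some q ∈ S.squareNext p ↔ ∃ e ∈ S.E, ∃ e' ∈ S.E, e.lab.letter = e'.lab.letter ∧
      (e.src, e'.src) = p ∧ (e.dst, e'.dst) = q := by
  simp only [squareNext, out, List.mem_map, List.mem_product, Prod.exists, List.mem_filter,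
    decide_eq_true_eq, Option.ite_none_right_eq_some, Option.some.injEq, Prod.ext_iff]
  constructor
  · rintro ⟨e, e', ⟨⟨h1, h2⟩, h3, h4⟩, h5, h6⟩
    exact ⟨e, h1, e', h3, h5, ⟨h2, h4⟩, h6⟩
  · rintro ⟨e, h1, e', h3, h5, ⟨h2, h4⟩, h6⟩
    exact ⟨e, e', ⟨⟨h1, h2⟩, h3, h4⟩, h5, h6⟩

theorem some_mem_squarePrev {S : Splitter A Q} {acc : List (Q × Q)} {p q : Q × Q} :
    some p ∈ S.squarePrev acc q ↔ ∃ e ∈ S.E, ∃ e' ∈ S.E, e.lab.letter = e'.lab.letter ∧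
      p ∈ acc ∧ (e.src, e'.src) = p ∧ (e.dst, e'.dst) = q := by
  simp only [squarePrev, into, List.mem_map, List.mem_product, Prod.exists, List.mem_filter,
    decide_eq_true_eq, Option.ite_none_right_eq_some, Option.some.injEq]
  constructor
  · rintro ⟨e, e', ⟨⟨h1, h2⟩, h3, h4⟩, ⟨h5, h7⟩, rfl⟩
    exact ⟨e, h1, e', h3, h5, h7, rfl, Prod.ext h2 h4⟩
  · rintro ⟨e, h1, e', h3, h5, h7, rfl, rfl⟩
    exact ⟨e, e', ⟨⟨h1, rfl⟩, h3, rfl⟩, ⟨h5, h7⟩, rfl⟩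

theorem some_mem_productNext {S : Splitter A Q} {QA : List (Q × Q)} {x y : ProductState A Q} :
    some y ∈ S.productNext QA x ↔ ∃ e ∈ S.E, ∃ e' ∈ S.E, e.lab.letter = e'.lab.letter ∧
      y.1 ∈ QA ∧ (e.src, e'.src) = x.1 ∧ (e.dst, e'.dst) = y.1 ∧
      LeadDelay.act₂ x.2 e.lab e'.lab = y.2 := by
  simp only [productNext, out, List.mem_map, List.mem_product, Prod.exists, List.mem_filter,
    decide_eq_true_eq, Option.ite_none_right_eq_some, Option.some.injEq]
  constructor
  · rintro ⟨e, e', ⟨⟨h1, h2⟩, h3, h4⟩, ⟨h5, h7⟩, rfl⟩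
    exact ⟨e, h1, e', h3, h5, h7, Prod.ext h2 h4, rfl, rfl⟩
  · rintro ⟨e, h1, e', h3, h5, h7, h2, h4, h6⟩
    exact ⟨e, e', ⟨⟨h1, congrArg Prod.fst h2⟩, h3, congrArg Prod.snd h2⟩, ⟨h5, h4 ▸ h7⟩,
      Prod.ext h4 h6⟩

theorem reachable_squareNext_iff {S : Splitter A Q} {p : Q × Q} :
    Reachable ((S.I ×ˢ S.I).map some) S.squareNext p ↔ S.Accessible p := by
  constructor
  · intro h
    induction h with
    | @init p hx =>
      obtain ⟨i, hi, hp⟩ := List.mem_map.1 hx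
      cases hp
      have := List.mem_product.1 hi
      exact ⟨p, [], this.1, this.2, .nil p⟩
    | next _ hx ih =>
      obtain ⟨i, w, hi, hi', hw⟩ := ih
      obtain ⟨e, he, e', he', hl, rfl, rfl⟩ := some_mem_squareNext.1 hx
      exact ⟨i, _, hi, hi', hw.trans (.singleton he he' hl)⟩
  · rintro ⟨i, w, hi, hi', hw⟩
    have hr : Reachable ((S.I ×ˢ S.I).map some) S.squareNext i :=
      .init (List.mem_map.2 ⟨i, List.mem_product.2 ⟨hi, hi'⟩, rfl⟩)
    clear hi hi'
    induction hw with
    | nil => exact hr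
    | cons e e' w q he he' hl _ ih =>
      exact ih (.next hr (some_mem_squareNext.2 ⟨e, he, e', he', hl, rfl, rfl⟩))

theorem reachable_squarePrev_iff {S : Splitter A Q} {acc : List (Q × Q)}
    (hacc : ∀ p, p ∈ acc ↔ S.Accessible p) {p : Q × Q} :
    Reachable ((S.T ×ˢ S.T).map fun p => if p ∈ acc then some p else none) (S.squarePrev acc) p ↔
      S.Accessible p ∧ S.Coaccessible p := by
  constructor
  · intro h
    induction h with
    | @init p hx =>
      obtain ⟨f, hf, hp⟩ := List.mem_map.1 hx
      obtain ⟨hp, h⟩ := Option.ite_none_right_eq_some.1 hp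
      cases h
      have := List.mem_product.1 hf
      exact ⟨(hacc _).1 hp, p, [], this.1, this.2, .nil p⟩
    | next _ hx ih =>
      obtain ⟨-, f, w, hf, hf', hw⟩ := ih
      obtain ⟨e, he, e', he', hl, hp, rfl, rfl⟩ := some_mem_squarePrev.1 hx
      exact ⟨(hacc _).1 hp, f, _, hf, hf', .cons e e' _ _ he he' hl hw⟩
  · rintro ⟨hp, f, w, hf, hf', hw⟩
    induction hw with
    | nil p =>
      refine .init (List.mem_map.2 ⟨p, List.mem_product.2 ⟨hf, hf'⟩, ?_⟩)
      rw [if_pos ((hacc _).2 hp)]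
    | cons e e' w q he he' hl _ ih =>
      have hq : S.Accessible (e.dst, e'.dst) := by
        obtain ⟨i, w, hi, hi', hw⟩ := hp
        exact ⟨i, _, hi, hi', hw.trans (.singleton he he' hl)⟩
      exact .next (ih hq hf hf')
        (some_mem_squarePrev.2 ⟨e, he, e', he', hl, (hacc _).2 hp, rfl, rfl⟩)

theorem reachable_productNext_iff {S : Splitter A Q} {QA : List (Q × Q)}
    (hQA : ∀ p, p ∈ QA ↔ S.Accessible p ∧ S.Coaccessible p) {x : ProductState A Q} :
    Reachable ((S.I ×ˢ S.I).map fun p =>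
        if p ∈ QA then some (p, (LeadDelay.start, LeadDelay.start)) else none)
      (S.productNext QA) x ↔
      x.1 ∈ QA ∧ ∃ i w, i.1 ∈ S.I ∧ i.2 ∈ S.I ∧ S.PairPath i w x.1 ∧ value w = x.2 := by
  constructor
  · intro h
    induction h with
    | @init x hx =>
      obtain ⟨i, hi, hp⟩ := List.mem_map.1 hx
      obtain ⟨hp', h⟩ := Option.ite_none_right_eq_some.1 hp
      cases h
      have := List.mem_product.1 hi
      exact ⟨hp', i, [], this.1, this.2, .nil _, value_nil⟩
    | next _ hx ih =>
      obtain ⟨-, i, w, hi, hi', hw, hv⟩ := ih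
      obtain ⟨e, he, e', he', hl, hp, hs, ht, h⟩ := some_mem_productNext.1 hx
      rw [← hs] at hw
      refine ⟨hp, i, _, hi, hi', ht ▸ hw.trans (.singleton he he' hl), ?_⟩
      rw [value_concat, hv, h]
  · obtain ⟨p, v⟩ := x
    rintro ⟨hp, i, w, hi, hi', hw, hv⟩
    simp only at hp hw hv
    subst hv
    -- `PairPath` grows at its front whereas values are updated at the end, so the induction carries
    -- the part `z` already read.
    suffices H : ∀ {q p : Q × Q} {w : List (Gen A × Gen A)}, S.PairPath q w p →
        ∀ z, S.PairPath i z q → p ∈ QA →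
        Reachable ((S.I ×ˢ S.I).map fun p =>
          if p ∈ QA then some (p, (LeadDelay.start, LeadDelay.start)) else none)
          (S.productNext QA) (q, value z) →
        Reachable ((S.I ×ˢ S.I).map fun p =>
          if p ∈ QA then some (p, (LeadDelay.start, LeadDelay.start)) else none)
          (S.productNext QA) (p, value (z ++ w)) by
      have hiQ : i ∈ QA := by
        obtain ⟨-, f, w', hf, hf', hw'⟩ := (hQA p).1 hp
        exact (hQA i).2 ⟨⟨i, [], hi, hi', .nil i⟩, f, _, hf, hf', hw.trans hw'⟩
      refine H hw [] (.nil i) hp (.init (List.mem_map.2 ⟨i, List.mem_product.2 ⟨hi, hi'⟩, ?_⟩))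
      rw [if_pos hiQ, value_nil]
    intro q p w hw
    induction hw with
    | nil q => intro z _ _ hr; simpa using hr
    | cons e e' w p he he' hl hw ih =>
      intro z hz hp hr
      have hz' := hz.trans (.singleton he he' hl)
      -- Intermediate states stay in the trim part: accessible by what was read, coaccessible
      -- through `p`.
      have hm : (e.dst, e'.dst) ∈ QA := by
        obtain ⟨-, f, w', hf, hf', hw'⟩ := (hQA p).1 hp
        exact (hQA _).2 ⟨⟨i, _, hi, hi', hz'⟩, f, _, hf, hf', hw.trans hw'⟩
      have := ih _ hz' hp (.next hr (some_mem_productNext.2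
        ⟨e, he, e', he', hl, hm, rfl, rfl, (value_concat _ _ _).symm⟩))
      simpa using this

/-! ### Costs -/

theorem sum_length_squareNext_le {S : Splitter A Q} {d : ℕ} (hd : ∀ q, (S.out q).length ≤ d)
    (l : List (Q × Q)) : (l.map fun p => (S.squareNext p).length).sum ≤ l.length * d ^ 2 := by
  refine (List.sum_le_card_nsmul _ (d ^ 2) fun n hn => ?_).trans (by simp)
  obtain ⟨p, -, rfl⟩ := List.mem_map.1 hn
  simpa [squareNext, sq, List.length_product] using Nat.mul_le_mul (hd p.1) (hd p.2)

theorem sum_length_productNext_le {S : Splitter A Q} {d : ℕ} (hd : ∀ q, (S.out q).length ≤ d)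
    (QA : List (Q × Q)) (l : List (ProductState A Q)) :
    (l.map fun x => (S.productNext QA x).length).sum ≤ l.length * d ^ 2 := by
  refine (List.sum_le_card_nsmul _ (d ^ 2) fun n hn => ?_).trans (by simp)
  obtain ⟨x, -, rfl⟩ := List.mem_map.1 hn
  simpa [productNext, sq, List.length_product] using Nat.mul_le_mul (hd x.1.1) (hd x.1.2)

theorem sum_length_filter_eq {α : Type*} [Fintype Q] (l : List α) (f : α → Q) :
    ∑ q, (l.filter fun e => f e = q).length = l.length := by
  induction l with
  | nil => simp
  | cons e l ih =>
    have : ∀ q, ((e :: l).filter fun e => f e = q).length =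
        (if f e = q then 1 else 0) + (l.filter fun e => f e = q).length := by
      intro q
      by_cases h : f e = q <;> simp [h, Nat.add_comm]
    simp only [this, Finset.sum_add_distrib, ih, Finset.sum_ite_eq, Finset.mem_univ, if_true,
      List.length_cons, Nat.add_comm]

/-- In-degrees are not bounded by `d`, so no bound per state is available. Summed over all of `Q ×
Q`, the pairs of entering transitions number `|E|²`, and out-degrees give `|E| ≤ d|Q|`. -/
theorem sum_length_squarePrev_le [Fintype Q] {S : Splitter A Q} {d : ℕ}
    (hd : ∀ q, (S.out q).length ≤ d) (acc : List (Q × Q)) {l : List (Q × Q)} (hl : l.Nodup) :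
    (l.map fun p => (S.squarePrev acc p).length).sum ≤ Fintype.card Q ^ 2 * d ^ 2 := by
  have hE : S.E.length ≤ Fintype.card Q * d := by
    rw [← sum_length_filter_eq S.E Transition.src]
    exact (Finset.sum_le_card_nsmul _ _ d fun q _ => hd q).trans (by simp)
  calc (l.map fun p => (S.squarePrev acc p).length).sum
      = ∑ p ∈ l.toFinset, (S.squarePrev acc p).length := (List.sum_toFinset _ hl).symm
    _ ≤ ∑ p, (S.squarePrev acc p).length :=
      Finset.sum_le_sum_of_subset (Finset.subset_univ _)
    _ = (∑ q, (S.into q).length) * ∑ q, (S.into q).length := by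
      rw [Finset.sum_mul_sum, Fintype.sum_prod_type]
      simp [squarePrev, List.length_product]
    _ = S.E.length * S.E.length := by
      simp only [into, sum_length_filter_eq]
    _ ≤ (Fintype.card Q * d) * (Fintype.card Q * d) := Nat.mul_le_mul hE hE
    _ = _ := by ring

/-! ### The whole procedure -/

/-- The last two phases of the procedure. -/
theorem exists_run_product [Fintype Q] {S : Splitter A Q} {QA : List (Q × Q)} (hnd : QA.Nodup)
    (hQA : ∀ p, p ∈ QA ↔ S.Accessible p ∧ S.Coaccessible p) (acc : List (Q × Q)) :
    ∃ t k answer, S.Run (.trim acc QA []) t k (.halt answer) ∧ (answer = true ↔ S.Functional) ∧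
      k ≤ 2 * Fintype.card Q ^ 2 ∧ ∀ d, (∀ q, (S.out q).length ≤ d) →
        t ≤ (2 + d ^ 2) * Fintype.card Q ^ 2 + 3 := by
  have hR := fun x => reachable_productNext_iff hQA (x := x)
  have hcard := length_le_card_sq hnd
  have hinit := length_product_le S.nodup_I
  -- The values range over a possibly infinite set, so termination rests on the cap `QA.length`.
  obtain ⟨l, t, k, hl, hk, ht, h⟩ := exists_run_explore (S.explores_product QA) [] _
    (.start (init := (S.I ×ˢ S.I).map fun p =>
      if p ∈ QA then some (p, (LeadDelay.start, LeadDelay.start)) else none)) (Nat.zero_le _)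
  simp only [List.length_nil, List.length_map, List.map_nil, List.sum_nil, Nat.add_zero] at hk ht
  have hcost : ∀ d, (∀ q, (S.out q).length ≤ d) →
      t ≤ Fintype.card Q ^ 2 + Fintype.card Q ^ 2 * d ^ 2 := fun d hd =>
    ht.trans (Nat.add_le_add hinit ((sum_length_productNext_le hd QA l).trans
      (Nat.mul_le_mul_right _ (hl.trans hcard))))
  rcases h with ⟨hr, hi⟩ | ⟨x, todo, hr, hlen, hx, hi⟩
  · obtain ⟨t', k', answer, hr', ht', hk', ha⟩ := S.exists_run_check QA l []
    refine ⟨t + (t' + 1) + 1, k + k', answer,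
      .idle rfl rfl (hr.trans (.idle rfl rfl hr')), ha.trans ?_, by omega, fun d hd => ?_⟩
    · rw [← consistent_iff_functional hnd hQA hR hi.nodup fun x => hi.mem_iff]
      simp
    · have := hcost d hd
      rw [add_mul, Nat.mul_comm (d ^ 2)]
      omega
  · have hstep : S.step (.product QA l (some x :: todo)) = .halt false := by
      simp only [step, if_neg hx, hlen]
      rw [if_pos (Nat.lt_succ_self _)]
    -- Pays for the aborting step, which counts as handling one state.
    have hpos : 0 < Fintype.card Q ^ 2 := pow_pos (Fintype.card_pos_iff.2 ⟨x.1.1⟩) 2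
    refine ⟨t + (0 + 1) + 1, k + (0 + 1), false, .idle rfl rfl
      (hr.trans (.work hstep ((S.explores_product QA).work_new _ _ _ hx) (.refl _))), ?_,
      by omega, fun d hd => ?_⟩
    · simp only [Bool.false_eq_true, false_iff]
      intro hS
      have := length_le_of_functional hS hQA hR (List.nodup_cons.2 ⟨hx, hi.nodup⟩) (by
        intro y hy
        rcases List.mem_cons.1 hy with rfl | hy
        · exact hi.todo_reachable _ (by simp)
        · exact hi.built_reachable y hy)
      rw [List.length_cons] at this
      omega
    · have := hcost d hd
      rw [add_mul, Nat.mul_comm (d ^ 2)]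
      omega

theorem exists_run_initial [Fintype Q] (S : Splitter A Q) :
    ∃ t k answer, S.Run S.initial t k (.halt answer) ∧ (answer = true ↔ S.Functional) ∧
      k ≤ 4 * Fintype.card Q ^ 2 ∧ ∀ d, (∀ q, (S.out q).length ≤ d) →
        t ≤ (4 + 3 * d ^ 2) * Fintype.card Q ^ 2 + 4 := by
  obtain ⟨acc, t₁, hr₁, hnd₁, hmem₁, ht₁⟩ :=
    exists_run_explore_of_card (S.explores_access _) ((S.I ×ˢ S.I).map some)
  have hacc := fun p => (hmem₁ p).trans reachable_squareNext_iff
  obtain ⟨QA, t₂, hr₂, hnd₂, hmem₂, ht₂⟩ :=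
    exists_run_explore_of_card (S.explores_trim acc _)
      ((S.T ×ˢ S.T).map fun p => if p ∈ acc then some p else none)
  have hQA := fun p => (hmem₂ p).trans (reachable_squarePrev_iff hacc)
  obtain ⟨t₃, k₃, answer, hr₃, ha, hk₃, ht₃⟩ := exists_run_product hnd₂ hQA acc
  have hc₁ := length_le_card_sq hnd₁
  have hc₂ := length_le_card_sq hnd₂
  -- The constant `4` counts three constructions and one check; the additive `4` in the step bound
  -- is the three passages between phases and the final halt.
  refine ⟨t₁ + (t₂ + t₃ + 1), acc.length + (QA.length + k₃), answer,
    hr₁.trans (.idle rfl rfl (hr₂.trans hr₃)), ha, by omega, fun d hd => ?_⟩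
  have h₁ := sum_length_squareNext_le hd acc
  have h₁' := Nat.mul_le_mul_right (d ^ 2) hc₁
  have h₂ := sum_length_squarePrev_le hd acc hnd₂
  have h₃ := ht₃ d hd
  have hI := length_product_le S.nodup_I
  have hT := length_product_le S.nodup_T
  rw [List.length_map] at ht₁ ht₂
  rw [add_mul, Nat.mul_comm (d ^ 2)] at h₃
  rw [add_mul, Nat.mul_assoc, Nat.mul_comm (d ^ 2)]
  omega

end Splitter

theorem mainTheorem3 :
    ∃ C : ℕ, ∀ (A Q : Type*) [DecidableEq A] [DecidableEq Q] [Fintype Q] (S : Splitter A Q),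
      ∃ (t : ℕ) (answer : Bool),
        S.configAt t = Config.halt answer ∧
        (answer = true ↔ S.Functional) ∧
        S.stateTime t ≤ C * Fintype.card Q ^ 2 ∧
        ∀ d : ℕ, (∀ q : Q, (S.out q).length ≤ d) →
          t ≤ C * ((1 + d ^ 2) * Fintype.card Q ^ 2 + 1) := by
  refine ⟨4, fun A Q _ _ _ S => ?_⟩
  obtain ⟨t, k, answer, hr, ha, hk, ht⟩ := S.exists_run_initial
  refine ⟨t, answer, hr.iterate_step, ha, hr.countP_handlesState.trans_le hk, fun d hd => ?_⟩
  have := ht d hd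
  nlinarith [Nat.zero_le (d ^ 2 * Fintype.card Q ^ 2)]
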